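/- **Theorem.** For $m\ge 0$ let $$P_m(a)=\sum_{j=0}^{m}\sum_{k=0}^{m-j}\binom{2m+1}{2j}\binom{m-j}{k}\binom{2k+2j}{k+j}\frac{(a+1)^j(a-1)^k}{2^{3(k+j)}}$$ be the Boros–Moll polynomial, let $d_i(m)$ be the coefficient of $a^i$ in $P_m(a)$ for $0\le i\le m$, and put $d_i(m)=0$ for $i<0$ and for $i>m$. For a finite real sequence $\{a_i\}_{0\le i\le n}$, with $a_i=0$ for $i<0$ and for $i>n$, let $\mathcal L(\{a_i\}_{0\le i\le n})=\{a_i^2-a_{i-1}a_{i+1}\}_{0\le i\le n}$. The sequence is called log-concave if $a_i^2-a_{i-1}a_{i+1}\ge 0$ for $1\le i\le n$, and $2$-log-concave if both it and $\mathcal L(\{a_i\}_{0\le i\le n})$ are log-concave. Then for every $m\ge 0$ the Boros–Moll sequence $\{d_i(m)\}_{0\le i\le m}$ is $2$-log-concave. Moreover, for all integers $1\le i\le m-1$, the denominators below are positive and $$\frac{d_{i-1}(m)^2-d_{i-2}(m)d_i(m)}{d_i(m)^2-d_{i-1}(m)d_{i+1}(m)}<\frac{d_i(m)^2-d_{i-1}(m)d_{i+1}(m)}{d_{i+1}(m)^2-d_i(m)d_{i+2}(m)}.$$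 -/

import Mathlib

open Polynomial

noncomputable section

/-- The Boros–Moll polynomial
`P_m(a) = ∑_{j,k} C(2m+1, 2j) C(m-j, k) C(2k+2j, k+j) (a+1)^j (a-1)^k / 2^{3(k+j)}`.
The factors `C(2m+1, 2j)` and `C(m-j, k)` restrict the sum to `0 ≤ j ≤ m`, `0 ≤ k ≤ m - j`,
so the natural-number subtraction `m - j` is never truncated. -/
def borosMollPoly (m : ℕ) : ℝ[X] :=
  ∑ j ∈ Finset.range (m + 1), ∑ k ∈ Finset.range (m - j + 1),
    C (((2 * m + 1).choose (2 * j) : ℝ) * ((m - j).choose k : ℝ)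
        * ((2 * k + 2 * j).choose (k + j) : ℝ) / 2 ^ (3 * (k + j)))
      * (X + 1) ^ j * (X - 1) ^ k

/-- The Boros–Moll sequence `{d_i(m)}_{0 ≤ i ≤ m}` of coefficients of `P_m(a)`. -/
def borosMollSeq (m : ℕ) : Fin (m + 1) → ℝ := fun i => (borosMollPoly m).coeff i

/-- The convention `a_i = 0` for indices `i < 0` or `i > n` of a sequence `{a_i}_{0 ≤ i ≤ n}`. -/
def zeroExtend {n : ℕ} (a : Fin (n + 1) → ℝ) (i : ℤ) : ℝ :=
  if h : 0 ≤ i ∧ i ≤ n then a ⟨i.toNat, by omega⟩ else 0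

/-- The operator `L({a_i}) = {a_i² - a_{i-1} a_{i+1}}` on sequences `{a_i}_{0 ≤ i ≤ n}`. -/
def logConcaveOp {n : ℕ} (a : Fin (n + 1) → ℝ) : Fin (n + 1) → ℝ := fun i =>
  zeroExtend a (i : ℕ) ^ 2 - zeroExtend a ((i : ℕ) - 1) * zeroExtend a ((i : ℕ) + 1)

/-- `{a_i}_{0 ≤ i ≤ n}` is log-concave: `a_i² - a_{i+1} a_{i-1} ≥ 0` for `1 ≤ i ≤ n`. -/
def IsLogConcaveSeq {n : ℕ} (a : Fin (n + 1) → ℝ) : Prop :=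
  ∀ i : ℤ, 1 ≤ i → i ≤ n →
    0 ≤ zeroExtend a i ^ 2 - zeroExtend a (i + 1) * zeroExtend a (i - 1)

/-- `{a_i}_{0 ≤ i ≤ n}` is `k`-log-concave: `L^j({a_i})` is log-concave for `0 ≤ j ≤ k - 1`. -/
def IsKLogConcaveSeq (k : ℕ) {n : ℕ} (a : Fin (n + 1) → ℝ) : Prop :=
  ∀ j < k, IsLogConcaveSeq (logConcaveOp^[j] a)

/-- `d_i(m)` for an integer index `i`, zero outside `0 ≤ i ≤ m`. -/
def borosMollCoeff (m : ℕ) (i : ℤ) : ℝ := zeroExtend (borosMollSeq m) i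

end

/-!
Write `d_i` for the coefficients of `P_m`, `M = m + 1/2`, `h = i - 1/2` and
`L_i = d_i² - d_{i-1} d_{i+1}`.

`P_m` is a Jacobi polynomial, so it satisfies the differential equation
`((X² - 1) P')' + (2m + 1) P' = m (m + 1) P` (`borosMollPoly_jacobi_ode`). This is proved straight
from the double sum by creative telescoping: applying the operator to the summands
`c_{jk} (X + 1)^j (X - 1)^k` and subtracting `((X + 1) - (X - 1) - 2) ∑ g_{jk} (X + 1)^j (X - 1)^k`,
which is zero, leaves a sum that vanishes termwise after shifting indices. Comparing coefficients
gives the three-term recurrence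
`(m + 1 - i) (m + i) d_{i-1} = i ((2m + 1) d_i - (i + 1) d_{i+1})`.

Put `i d_i / d_{i-1} = M - w_i`. The recurrence becomes the stable downward iteration
`w_i = (M w_{i+1} + h²) / (M + w_{i+1})` with `w_{m+1} = M`, and downward induction gives positivity
of the `d_i` and the bounds `h ≤ w_i` and `w_i² ≤ h² + (M - h)` (`exists_ratio_parameter`). The lower
bound yields `L_i > 0`.

By the recurrence `d_{i-2}, …, d_{i+2}` are all multiples of `d_{i-1}` with coefficients rational in
`w = w_i`, so `L_{i-1} L_{i+1} < L_i²` is a polynomial inequality in `w`. It reduces to positivity of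
the quintic `ratioGap`. In the variables `k = i - 1`, `d = w - h ≥ 0` and
`p = (M - h) - (w² - h²) ≥ 0` nearly all coefficients of that quintic are nonnegative, and the few
negative ones, all free of `p`, are absorbed using `(w² - h²) + p = m + 1 - i ≥ 2`
(`ratioGap_pos`).
-/

/-! ### Coefficients of the defining double sum -/

/-- The coefficient of `(a + 1) ^ j * (a - 1) ^ k` in the defining double sum of `P_m(a)`. It
vanishes unless `j + k ≤ m`. -/
noncomputable def borosMollTerm (m j k : ℕ) : ℝ :=
  ((2 * m + 1).choose (2 * j) : ℝ) * ((m - j).choose k : ℝ)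
    * ((2 * k + 2 * j).choose (k + j) : ℝ) / 2 ^ (3 * (k + j))

lemma borosMollTerm_eq_zero {m j k : ℕ} (h : m < j + k) : borosMollTerm m j k = 0 := by
  unfold borosMollTerm
  rcases lt_or_ge m j with hj | hj
  · rw [Nat.choose_eq_zero_of_lt (by omega : 2 * m + 1 < 2 * j)]; simp
  · rw [Nat.choose_eq_zero_of_lt (by omega : m - j < k)]; simp

lemma borosMollTerm_nonneg (m j k : ℕ) : 0 ≤ borosMollTerm m j k := by
  unfold borosMollTerm; positivity

/-- The step `(j, k + 1) → (j + 1, k)` keeps `j + k`, so the central binomial coefficient and the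
power of two do not change. -/
lemma borosMollTerm_succ_left (m j k : ℕ) :
    borosMollTerm m (j + 1) k * ((j + 1) * (2 * j + 1))
      = (2 * m + 1 - 2 * j) * (k + 1) * borosMollTerm m j (k + 1) := by
  rcases lt_or_ge j m with hj | hj
  · obtain ⟨t, rfl⟩ := Nat.exists_eq_add_of_lt hj
    have e1 := Nat.choose_succ_right_eq (2 * (j + t + 1) + 1) (2 * j)
    have e2 := Nat.choose_succ_right_eq (2 * (j + t + 1) + 1) (2 * j + 1)
    have e3 := Nat.add_one_mul_choose_eq t k
    rw [show 2 * (j + t + 1) + 1 - 2 * j = 2 * t + 3 by omega] at e1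
    rw [show 2 * (j + t + 1) + 1 - (2 * j + 1) = 2 * t + 2 by omega] at e2
    have e1' : ((2 * (j + t + 1) + 1).choose (2 * j + 1) : ℝ) * (2 * j + 1)
        = (2 * (j + t + 1) + 1).choose (2 * j) * (2 * t + 3) := by exact_mod_cast e1
    have e2' : ((2 * (j + t + 1) + 1).choose (2 * j + 2) : ℝ) * (2 * j + 1 + 1)
        = (2 * (j + t + 1) + 1).choose (2 * j + 1) * (2 * t + 2) := by exact_mod_cast e2
    have e3' : ((t : ℝ) + 1) * t.choose k = (t + 1).choose (k + 1) * (k + 1) := by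
      exact_mod_cast e3
    unfold borosMollTerm
    rw [show j + t + 1 - (j + 1) = t by omega, show j + t + 1 - j = t + 1 by omega,
      show 2 * (j + 1) = 2 * j + 2 by ring,
      show 2 * k + (2 * j + 2) = 2 * (k + 1) + 2 * j by ring,
      show k + (j + 1) = k + 1 + j by ring]
    generalize ((2 * (k + 1) + 2 * j).choose (k + 1 + j) : ℝ) = c
    have hp : (2 : ℝ) ^ (3 * (k + 1 + j)) ≠ 0 := by positivity
    field_simp
    push_cast
    linear_combination c * t.choose k * (2 * j + 1) / 2 * e2'
      + c * t.choose k * (t + 1) * e1'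
      + c * ((2 * (j + t + 1) + 1).choose (2 * j) : ℝ) * (2 * t + 3) * e3'
  · rw [borosMollTerm_eq_zero (by omega), borosMollTerm_eq_zero (by omega)]; ring

lemma borosMollTerm_succ_right (m j k : ℕ) :
    ((m : ℝ) - (j + k)) * (2 * (j + k) + 1) * borosMollTerm m j k
      = 4 * (k + 1) * (j + k + 1) * borosMollTerm m j (k + 1) := by
  rcases le_or_gt (j + k) m with hj | hj
  · have e1 := Nat.choose_succ_right_eq (m - j) k
    have e1' : ((m - j).choose (k + 1) : ℝ) * (k + 1) = (m - j).choose k * (m - (j + k)) := by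
      have : ((m - j - k : ℕ) : ℝ) = m - (j + k) := by
        rw [Nat.sub_sub, Nat.cast_sub hj]; push_cast; ring
      rw [← this]; exact_mod_cast e1
    have e2 := Nat.succ_mul_centralBinom_succ (k + j)
    simp only [Nat.centralBinom] at e2
    have e2' : ((k : ℝ) + j + 1) * (2 * (k + j + 1)).choose (k + j + 1)
        = 2 * (2 * (k + j) + 1) * (2 * (k + j)).choose (k + j) := by exact_mod_cast e2
    unfold borosMollTerm
    rw [show 2 * (k + 1) + 2 * j = 2 * (k + j + 1) by ring, show k + 1 + j = k + j + 1 by ring,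
      show 2 * k + 2 * j = 2 * (k + j) by ring, show 3 * (k + j + 1) = 3 * (k + j) + 3 by ring,
      pow_add]
    have hp : (2 : ℝ) ^ (3 * (k + j)) ≠ 0 := by positivity
    field_simp
    linear_combination (-4 : ℝ) * ((2 * m + 1).choose (2 * j)) * (m - j).choose (k + 1) * (k + 1) * e2'
      - 8 * ((2 * m + 1).choose (2 * j)) * (2 * (k + j) + 1) * (2 * (k + j)).choose (k + j) * e1'
  · rw [borosMollTerm_eq_zero hj, borosMollTerm_eq_zero (by omega)]; ring

/-- Summing over a full square instead of a triangle makes the index shifts below boundary-free. -/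
lemma borosMollPoly_eq_sum_square (m : ℕ) :
    borosMollPoly m = ∑ j ∈ Finset.range (m + 1), ∑ k ∈ Finset.range (m + 1),
      C (borosMollTerm m j k) * ((X + 1) ^ j * (X - 1) ^ k) := by
  unfold borosMollPoly
  refine Finset.sum_congr rfl fun j _ => ?_
  have hsub : Finset.range (m - j + 1) ⊆ Finset.range (m + 1) :=
    Finset.range_mono (by omega)
  rw [← Finset.sum_subset hsub]
  · refine Finset.sum_congr rfl fun k _ => ?_
    rw [borosMollTerm, mul_assoc]
  · intro k _ hk
    rw [borosMollTerm_eq_zero (by simp at hk; omega)]; simp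

/-! ### The Jacobi differential equation -/

lemma sum_range_shift {A : Type*} [AddCommGroup A] {N : ℕ} {f : ℕ → A} (h0 : f 0 = 0)
    (hN : f N = 0) : ∑ j ∈ Finset.range N, f (j + 1) = ∑ j ∈ Finset.range N, f j := by
  have := Finset.sum_range_succ' f N
  rw [Finset.sum_range_succ, h0, hN] at this
  simpa using this.symm

lemma derivative_shifted_monomial (j k : ℕ) :
    derivative ((X + 1 : ℝ[X]) ^ j * (X - 1) ^ k)
      = (j : ℝ[X]) * ((X + 1) ^ (j - 1) * (X - 1) ^ k)
        + (k : ℝ[X]) * ((X + 1) ^ j * (X - 1) ^ (k - 1)) := by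
  simp [derivative_mul, derivative_pow]
  ring

/-- Twice the Jacobi operator maps `(X + 1) ^ j * (X - 1) ^ k` to a combination of such products of
the same total degree `j + k`; the factor `2` is `(X + 1) - (X - 1)`, which homogenizes the
first-order term. The truncated exponents `j - 1` and `k - 1` come with the factors `j` and `k`. -/
lemma jacobi_operator_shifted_monomial (m j k : ℕ) :
    2 * (derivative (derivative ((X + 1 : ℝ[X]) ^ j * (X - 1) ^ k) * (X ^ 2 - 1))
      + (2 * (m : ℝ[X]) + 1) * derivative ((X + 1 : ℝ[X]) ^ j * (X - 1) ^ k)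
      - (m : ℝ[X]) * ((m : ℝ[X]) + 1) * ((X + 1 : ℝ[X]) ^ j * (X - 1) ^ k))
    = (2 * (k : ℝ[X]) + 2 * (m : ℝ[X]) + 1) * (k : ℝ[X]) * ((X + 1) ^ (j + 1) * (X - 1) ^ (k - 1))
      + (2 * (j : ℝ[X]) - (2 * (m : ℝ[X]) + 1)) * (j : ℝ[X])
        * ((X + 1) ^ (j - 1) * (X - 1) ^ (k + 1))
      + ((2 * (j : ℝ[X]) - (2 * (m : ℝ[X]) + 1)) * ((k : ℝ[X]) + 1)
          + (2 * (k : ℝ[X]) + 2 * (m : ℝ[X]) + 1) * ((j : ℝ[X]) + 1)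
          - 2 * (m : ℝ[X]) * ((m : ℝ[X]) + 1)) * ((X + 1) ^ j * (X - 1) ^ k) := by
  -- `X ^ 2 - 1 = (X + 1) * (X - 1)` absorbs the first derivative, so none of order two is expanded.
  have e1 : derivative ((X + 1 : ℝ[X]) ^ j * (X - 1) ^ k) * (X ^ 2 - 1)
      = (j : ℝ[X]) * ((X + 1) ^ j * (X - 1) ^ (k + 1))
        + (k : ℝ[X]) * ((X + 1) ^ (j + 1) * (X - 1) ^ k) := by
    rw [derivative_shifted_monomial]
    rcases j with _ | j <;> rcases k with _ | k <;> simp <;> ring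
  have e2 : 2 * derivative ((X + 1 : ℝ[X]) ^ j * (X - 1) ^ k)
      = derivative ((X + 1 : ℝ[X]) ^ (j + 1) * (X - 1) ^ k)
        - derivative ((X + 1 : ℝ[X]) ^ j * (X - 1) ^ (k + 1)) := by
    rw [← derivative_sub, show (X + 1 : ℝ[X]) ^ (j + 1) * (X - 1) ^ k
      - (X + 1 : ℝ[X]) ^ j * (X - 1) ^ (k + 1) = C 2 * ((X + 1 : ℝ[X]) ^ j * (X - 1) ^ k) by
        rw [show (C 2 : ℝ[X]) = 2 from rfl]; ring, derivative_C_mul]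
    rfl
  have e3 : derivative (derivative ((X + 1 : ℝ[X]) ^ j * (X - 1) ^ k) * (X ^ 2 - 1))
      = (j : ℝ[X]) * derivative ((X + 1 : ℝ[X]) ^ j * (X - 1) ^ (k + 1))
        + (k : ℝ[X]) * derivative ((X + 1 : ℝ[X]) ^ (j + 1) * (X - 1) ^ k) := by
    rw [e1]; simp only [derivative_add, derivative_natCast_mul]
  have d1 := derivative_shifted_monomial j (k + 1)
  have d2 := derivative_shifted_monomial (j + 1) k
  simp only [Nat.add_sub_cancel] at d1 d2
  push_cast at d1 d2
  rw [e3]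
  linear_combination (2 * (m : ℝ[X]) + 1) * e2 + (2 * (j : ℝ[X]) - (2 * (m : ℝ[X]) + 1)) * d1
    + (2 * (k : ℝ[X]) + 2 * (m : ℝ[X]) + 1) * d2

/-- `P_m` solves the Jacobi equation with parameters `α = m + 1/2`, `β = -(m + 1/2)`. -/
theorem borosMollPoly_jacobi_ode (m : ℕ) :
    derivative (derivative (borosMollPoly m) * (X ^ 2 - 1))
      + (2 * (m : ℝ[X]) + 1) * derivative (borosMollPoly m)
      = (m : ℝ[X]) * ((m : ℝ[X]) + 1) * borosMollPoly m := by
  set T : ℕ → ℕ → ℝ[X] := fun j k => (X + 1) ^ j * (X - 1) ^ k with hT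
  set c := borosMollTerm m with hc
  have hP : borosMollPoly m = ∑ j ∈ Finset.range (m + 1), ∑ k ∈ Finset.range (m + 1),
      C (c j k) * T j k := borosMollPoly_eq_sum_square m
  -- The telescoping certificate: `∑ g j k * T j k` is multiplied by the zero polynomial
  -- `(X + 1) - (X - 1) - 2` and subtracted.
  set g : ℕ → ℕ → ℝ := fun j k =>
    (m + 1) * (m - (j + k)) * (2 * (j + k) + 1) / (2 * j + 1) * c j k with hg
  have hg' : ∀ j k : ℕ, g j k = 4 * (m + 1) * (k + 1) * (j + k + 1) / (2 * j + 1) * c j (k + 1) := by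
    intro j k
    have h := borosMollTerm_succ_right m j k
    have h1 : (2 * (j : ℝ) + 1) ≠ 0 := by positivity
    simp only [hg]
    field_simp
    linear_combination h
  have hR1 : ∀ j k : ℕ, c (j + 1) k
      = (2 * m + 1 - 2 * j) * (k + 1) / ((j + 1) * (2 * j + 1)) * c j (k + 1) := by
    intro j k
    have h := borosMollTerm_succ_left m j k
    have h1 : (2 * (j : ℝ) + 1) ≠ 0 := by positivity
    have h2 : ((j : ℝ) + 1) ≠ 0 := by positivity
    field_simp
    linear_combination h
  -- `α`, `β`, `γ` are the coefficients of the operator on `T j k`; `x` and `y` express the shifted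
  -- coefficients, corrected by `g`, as multiples of `c j k`.
  set α : ℕ → ℝ := fun j => (2 * j - (2 * m + 1)) * j with hα
  set β : ℕ → ℝ := fun k => (2 * k + 2 * m + 1) * k with hβ
  set x : ℕ → ℕ → ℝ := fun j k =>
    -(k * ((2 * m - 2 * j) ^ 2 - 1 - 4 * (m + 1) * (j + k)) / (2 * j + 1)) with hx
  set y : ℕ → ℕ → ℝ := fun j k => -(j * (2 * k + 1)) with hy
  set γ : ℕ → ℕ → ℝ := fun j k => (2 * j - (2 * m + 1)) * (k + 1)
    + (2 * k + 2 * m + 1) * (j + 1) - 2 * m * (m + 1) with hγ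
  have hA : ∀ j k, α (j + 1) * c (j + 1) k + g j k = x j (k + 1) * c j (k + 1) := by
    intro j k
    rw [hR1, hg']
    have h1 : (2 * (j : ℝ) + 1) ≠ 0 := by positivity
    have h2 : ((j : ℝ) + 1) ≠ 0 := by positivity
    simp only [hα, hx]
    push_cast
    field_simp
    ring
  have hB : ∀ j k, β (k + 1) * c j (k + 1) - g j k = y (j + 1) k * c (j + 1) k := by
    intro j k
    rw [hR1, hg']
    have h1 : (2 * (j : ℝ) + 1) ≠ 0 := by positivity
    have h2 : ((j : ℝ) + 1) ≠ 0 := by positivity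
    simp only [hβ, hy]
    push_cast
    field_simp
    ring
  have hC : ∀ j k, γ j k * c j k + 2 * g j k + x j k * c j k + y j k * c j k = 0 := by
    intro j k
    have h1 : (2 * (j : ℝ) + 1) ≠ 0 := by positivity
    simp only [hγ, hg, hx, hy]
    field_simp
    ring
  have hc0 : ∀ j k, m < j + k → c j k = 0 := fun j k h => borosMollTerm_eq_zero h
  have hβ0 : β 0 = 0 := by simp [hβ]
  have hα0 : α 0 = 0 := by simp [hα]
  have hx0 : ∀ j, x j 0 = 0 := by simp [hx]
  have hy0 : ∀ k, y 0 k = 0 := by simp [hy]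
  have S1 : ∑ j ∈ Finset.range (m + 1), ∑ k ∈ Finset.range (m + 1),
        C (β (k + 1) * c j (k + 1)) * T (j + 1) k
      = ∑ j ∈ Finset.range (m + 1), ∑ k ∈ Finset.range (m + 1),
        C (β k * c j k) * T (j + 1) (k - 1) := by
    refine Finset.sum_congr rfl fun j _ => ?_
    refine sum_range_shift (f := fun k => C (β k * c j k) * T (j + 1) (k - 1)) ?_ ?_
    · simp [hβ0]
    · simp [hc0 j (m + 1) (by omega)]
  have S2 : ∑ j ∈ Finset.range (m + 1), ∑ k ∈ Finset.range (m + 1),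
        C (α (j + 1) * c (j + 1) k) * T j (k + 1)
      = ∑ j ∈ Finset.range (m + 1), ∑ k ∈ Finset.range (m + 1),
        C (α j * c j k) * T (j - 1) (k + 1) := by
    refine sum_range_shift (f := fun j => ∑ k ∈ Finset.range (m + 1),
      C (α j * c j k) * T (j - 1) (k + 1)) ?_ ?_
    · simp [hα0]
    · exact Finset.sum_eq_zero fun k _ => by simp [hc0 (m + 1) k (by omega)]
  have S3 : ∑ j ∈ Finset.range (m + 1), ∑ k ∈ Finset.range (m + 1),
        C (y (j + 1) k * c (j + 1) k) * T (j + 1) k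
      = ∑ j ∈ Finset.range (m + 1), ∑ k ∈ Finset.range (m + 1), C (y j k * c j k) * T j k := by
    refine sum_range_shift (f := fun j => ∑ k ∈ Finset.range (m + 1),
      C (y j k * c j k) * T j k) ?_ ?_
    · simp [hy0]
    · exact Finset.sum_eq_zero fun k _ => by simp [hc0 (m + 1) k (by omega)]
  have S4 : ∑ j ∈ Finset.range (m + 1), ∑ k ∈ Finset.range (m + 1),
        C (x j (k + 1) * c j (k + 1)) * T j (k + 1)
      = ∑ j ∈ Finset.range (m + 1), ∑ k ∈ Finset.range (m + 1), C (x j k * c j k) * T j k := by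
    refine Finset.sum_congr rfl fun j _ => ?_
    refine sum_range_shift (f := fun k => C (x j k * c j k) * T j k) ?_ ?_
    · simp [hx0]
    · simp [hc0 j (m + 1) (by omega)]
  have key : 2 * (derivative (derivative (borosMollPoly m) * (X ^ 2 - 1))
      + (2 * (m : ℝ[X]) + 1) * derivative (borosMollPoly m)
      - (m : ℝ[X]) * ((m : ℝ[X]) + 1) * borosMollPoly m) = 0 := by
    calc _ = ∑ j ∈ Finset.range (m + 1), ∑ k ∈ Finset.range (m + 1), C (c j k) *
          (2 * (derivative (derivative (T j k) * (X ^ 2 - 1))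
          + (2 * (m : ℝ[X]) + 1) * derivative (T j k)
          - (m : ℝ[X]) * ((m : ℝ[X]) + 1) * T j k)) := by
          rw [hP]
          simp only [derivative_sum, derivative_C_mul, Finset.sum_mul, Finset.mul_sum, mul_assoc,
            ← Finset.sum_add_distrib, ← Finset.sum_sub_distrib]
          refine Finset.sum_congr rfl fun j _ => Finset.sum_congr rfl fun k _ => ?_
          ring
      _ = ∑ j ∈ Finset.range (m + 1), ∑ k ∈ Finset.range (m + 1),
            C (β k * c j k) * T (j + 1) (k - 1)
          + ∑ j ∈ Finset.range (m + 1), ∑ k ∈ Finset.range (m + 1),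
            C (α j * c j k) * T (j - 1) (k + 1)
          + ∑ j ∈ Finset.range (m + 1), ∑ k ∈ Finset.range (m + 1),
            C (γ j k * c j k) * T j k := by
          simp only [← Finset.sum_add_distrib]
          refine Finset.sum_congr rfl fun j _ => Finset.sum_congr rfl fun k _ => ?_
          rw [jacobi_operator_shifted_monomial]
          simp only [hα, hβ, hγ, hT, map_mul, map_add, map_sub, map_natCast, map_one,
            map_ofNat]
          ring
      _ = ∑ j ∈ Finset.range (m + 1), ∑ k ∈ Finset.range (m + 1),
            C (y (j + 1) k * c (j + 1) k) * T (j + 1) k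
          + ∑ j ∈ Finset.range (m + 1), ∑ k ∈ Finset.range (m + 1),
            C (x j (k + 1) * c j (k + 1)) * T j (k + 1)
          + ∑ j ∈ Finset.range (m + 1), ∑ k ∈ Finset.range (m + 1),
            C (γ j k * c j k + 2 * g j k) * T j k := by
          rw [← S1, ← S2]
          simp only [← Finset.sum_add_distrib]
          refine Finset.sum_congr rfl fun j _ => Finset.sum_congr rfl fun k _ => ?_
          rw [← hA, ← hB]
          simp only [hT, map_add, map_sub, map_mul, map_ofNat]
          ring
      _ = 0 := by
          rw [S3, S4]
          simp only [← Finset.sum_add_distrib]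
          refine Finset.sum_eq_zero fun j _ => Finset.sum_eq_zero fun k _ => ?_
          rw [← add_mul, ← add_mul, ← map_add, ← map_add,
            show y j k * c j k + x j k * c j k + (γ j k * c j k + 2 * g j k) = 0 by
              linear_combination hC j k]
          simp
  exact sub_eq_zero.mp ((mul_eq_zero.mp key).resolve_left two_ne_zero)

/-! ### The three-term recurrence and the leading coefficient -/

/-- The three-term recurrence of the coefficients of `P_m` for fixed `m`. -/
theorem borosMollPoly_coeff_recurrence (m n : ℕ) :
    ((m : ℝ) - n) * (m + 1 + n) * (borosMollPoly m).coeff n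
      = (n + 1) * ((2 * m + 1) * (borosMollPoly m).coeff (n + 1)
        - (n + 2) * (borosMollPoly m).coeff (n + 2)) := by
  have h := congrArg (fun p => p.coeff n) (borosMollPoly_jacobi_ode m)
  have e1 : (2 * (m : ℝ[X]) + 1) = C (2 * (m : ℝ) + 1) := by
    simp only [map_add, map_mul, map_ofNat, map_natCast, map_one]
  have e2 : (m : ℝ[X]) * ((m : ℝ[X]) + 1) = C ((m : ℝ) * (m + 1)) := by simp
  rw [e1, e2] at h
  simp only [coeff_add, coeff_C_mul, mul_sub, mul_one, derivative_sub, coeff_sub] at h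
  simp only [coeff_derivative] at h
  rcases n with _ | n
  · simp [coeff_mul_X_pow'] at h
    push_cast
    linear_combination -h
  · simp [coeff_mul_X_pow', coeff_derivative] at h
    push_cast
    linear_combination -h

lemma shifted_monomial_monic (j k : ℕ) : ((X + 1 : ℝ[X]) ^ j * (X - 1) ^ k).Monic :=
  ((monic_X_add_C (1 : ℝ)).pow j).mul ((monic_X_sub_C (1 : ℝ)).pow k)

lemma shifted_monomial_natDegree (j k : ℕ) :
    ((X + 1 : ℝ[X]) ^ j * (X - 1) ^ k).natDegree = j + k := by
  have h1 : (X + 1 : ℝ[X]).natDegree = 1 := natDegree_X_add_C (1 : ℝ)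
  have h2 : (X - 1 : ℝ[X]).natDegree = 1 := natDegree_X_sub_C (1 : ℝ)
  have m1 : (X + 1 : ℝ[X]).Monic := monic_X_add_C (1 : ℝ)
  have m2 : (X - 1 : ℝ[X]).Monic := monic_X_sub_C (1 : ℝ)
  rw [Monic.natDegree_mul (m1.pow j) (m2.pow k),
    natDegree_pow, natDegree_pow, h1, h2, mul_one, mul_one]

lemma borosMollPoly_coeff_eq_zero {m n : ℕ} (h : m < n) : (borosMollPoly m).coeff n = 0 := by
  rw [borosMollPoly_eq_sum_square]
  simp only [finsetSum_coeff, coeff_C_mul]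
  refine Finset.sum_eq_zero fun j _ => Finset.sum_eq_zero fun k _ => ?_
  rcases lt_or_ge m (j + k) with hjk | hjk
  · rw [borosMollTerm_eq_zero hjk, zero_mul]
  · rw [coeff_eq_zero_of_natDegree_lt, mul_zero]
    rw [shifted_monomial_natDegree]; omega

/-- Only the terms with `j + k = m` contribute to the coefficient of `X ^ m`, each with the
nonnegative weight `borosMollTerm m j k`. -/
lemma borosMollPoly_coeff_self_pos (m : ℕ) : 0 < (borosMollPoly m).coeff m := by
  rw [borosMollPoly_eq_sum_square]
  simp only [finsetSum_coeff, coeff_C_mul]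
  have htop : ∀ j k : ℕ, j + k = m → ((X + 1 : ℝ[X]) ^ j * (X - 1) ^ k).coeff m = 1 := by
    rintro j k rfl
    rw [← shifted_monomial_natDegree]
    exact shifted_monomial_monic j k
  have hnn : ∀ j k : ℕ,
      0 ≤ borosMollTerm m j k * ((X + 1 : ℝ[X]) ^ j * (X - 1) ^ k).coeff m := by
    intro j k
    rcases lt_trichotomy m (j + k) with hjk | hjk | hjk
    · rw [borosMollTerm_eq_zero hjk, zero_mul]
    · rw [htop j k hjk.symm, mul_one]; exact borosMollTerm_nonneg _ _ _
    · rw [coeff_eq_zero_of_natDegree_lt (by rwa [shifted_monomial_natDegree]), mul_zero]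
  refine Finset.sum_pos' (fun j _ => Finset.sum_nonneg fun k _ => hnn j k)
    ⟨0, by simp, Finset.sum_pos' (fun k _ => hnn 0 k) ⟨m, by simp, ?_⟩⟩
  rw [htop 0 m (zero_add m), mul_one]
  have : 0 < (2 * m + 2 * 0).choose (m + 0) := Nat.choose_pos (by omega)
  simp only [borosMollTerm, Nat.mul_zero, Nat.choose_zero_right, Nat.sub_zero, Nat.choose_self]
  simp only [Nat.mul_zero] at this
  positivity

lemma borosMollCoeff_natCast (m n : ℕ) : borosMollCoeff m n = (borosMollPoly m).coeff n := by
  unfold borosMollCoeff zeroExtend borosMollSeq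
  split_ifs with h
  · simp
  · exact (borosMollPoly_coeff_eq_zero (by omega)).symm

lemma borosMollCoeff_of_neg {m : ℕ} {i : ℤ} (hi : i < 0) : borosMollCoeff m i = 0 := by
  unfold borosMollCoeff zeroExtend
  exact dif_neg (by omega)

lemma borosMollCoeff_of_gt {m : ℕ} {i : ℤ} (hi : (m : ℤ) < i) : borosMollCoeff m i = 0 := by
  unfold borosMollCoeff zeroExtend
  exact dif_neg (by omega)

lemma borosMollCoeff_self_pos (m : ℕ) : 0 < borosMollCoeff m m := by
  rw [borosMollCoeff_natCast]
  exact borosMollPoly_coeff_self_pos m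

/-- At `i = 0` the recurrence reads `0 = 0`, because `d_{-1} = 0`. -/
lemma borosMollCoeff_recurrence (m : ℕ) {i : ℤ} (hi : 0 ≤ i) :
    ((m : ℝ) + 1 - i) * (m + i) * borosMollCoeff m (i - 1)
      = i * ((2 * m + 1) * borosMollCoeff m i - (i + 1) * borosMollCoeff m (i + 1)) := by
  obtain ⟨n, rfl⟩ := Int.eq_ofNat_of_zero_le hi
  rcases n with _ | n
  · simp [borosMollCoeff_of_neg]
  · have h := borosMollPoly_coeff_recurrence m n
    rw [show ((n + 1 : ℕ) : ℤ) - 1 = (n : ℕ) by push_cast; ring,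
      show ((n + 1 : ℕ) : ℤ) + 1 = (n + 2 : ℕ) by push_cast; ring]
    simp only [borosMollCoeff_natCast]
    push_cast
    linear_combination h

/-! ### Bounds for consecutive ratios -/

/-- Positivity of `d_{i-1}` and, with `M = m + 1/2` and `h = i - 1/2`, the bounds
`h ≤ w` and `w² ≤ h² + (M - h)` for the number `w = M - i d_i / d_{i-1}`, by downward induction
from `w = M` at `i = m + 1`. -/
lemma exists_ratio_parameter (m : ℕ) {i : ℤ} (hi1 : 1 ≤ i) (him : i ≤ m + 1) :
    0 < borosMollCoeff m (i - 1) ∧ ∃ w : ℝ,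
      i * borosMollCoeff m i = ((m : ℝ) + 1 / 2 - w) * borosMollCoeff m (i - 1) ∧
      (i : ℝ) - 1 / 2 ≤ w ∧
      w ^ 2 ≤ ((i : ℝ) - 1 / 2) ^ 2 + ((m : ℝ) + 1 / 2 - (i - 1 / 2)) := by
  induction i, him using Int.leInductionDown with
  | base =>
    refine ⟨by simpa using borosMollCoeff_self_pos m, (m : ℝ) + 1 / 2, ?_, ?_, ?_⟩
    · rw [borosMollCoeff_of_gt (by omega)]; ring
    · push_cast; linarith
    · push_cast; apply le_of_eq; ring
  | pred i him ih =>
    obtain ⟨hD, w', hw', hlo, hhi⟩ := ih (by omega)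
    generalize hj : i - 1 = j at *
    obtain rfl : i = j + 1 := by omega
    have hr := borosMollCoeff_recurrence m (i := j) (by omega)
    have hj1 : (1 : ℝ) ≤ j := by exact_mod_cast hi1
    have hjm : (j : ℝ) ≤ m := by exact_mod_cast (by omega : j ≤ m)
    push_cast at hw' hlo hhi
    set M : ℝ := (m : ℝ) + 1 / 2 with hM
    set h : ℝ := (j : ℝ) - 1 / 2 with hh
    have hhM : 1 ≤ M - h := by linarith
    have hh0 : 0 < h := by linarith
    have hw0 : 0 < M + w' := by linarith
    have hr' : (M ^ 2 - h ^ 2) * borosMollCoeff m (j - 1)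
        = j * (M + w') * borosMollCoeff m j := by
      linear_combination hr - j * hw'
    have hMh : 0 < M ^ 2 - h ^ 2 := by nlinarith
    refine ⟨?_, (M * w' + h ^ 2) / (M + w'), ?_, ?_, ?_⟩
    · have : 0 < (M ^ 2 - h ^ 2) * borosMollCoeff m (j - 1) := by
        rw [hr']; positivity
      exact (pos_iff_pos_of_mul_pos this).mp hMh
    · field_simp
      linear_combination -hr'
    · rw [le_div_iff₀ hw0]; nlinarith
    · rw [div_pow, div_le_iff₀ (by positivity)]
      have hw2 : 0 ≤ h ^ 2 + h + M - w' ^ 2 := by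
        have e : (j : ℝ) = h + 1 / 2 := by rw [hh]; ring
        rw [e] at hhi
        linarith [show (h + 1 / 2 + 1 - 1 / 2) ^ 2 + (M - (h + 1 / 2 + 1 - 1 / 2)) = h ^ 2 + h + M by
          ring]
      -- The map `w' ↦ (M w' + h²) / (M + w')` is increasing, so the extreme case is
      -- `w'² = h² + h + M`; there the difference is `2 M (M - h) (w' - h) + M² - h²`.
      have h1 : 0 ≤ (M - h) * (M + h - 1) * (h ^ 2 + h + M - w' ^ 2) :=
        mul_nonneg (mul_nonneg (by linarith) (by linarith)) hw2
      have h2 : 0 ≤ 2 * M * (M - h) * (w' - h) :=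
        mul_nonneg (mul_nonneg (by linarith) (by linarith)) (by linarith)
      linarith [show (h ^ 2 + (M - h)) * (M + w') ^ 2 - (M * w' + h ^ 2) ^ 2
        = (M - h) * (M + h - 1) * (h ^ 2 + h + M - w' ^ 2) + 2 * M * (M - h) * (w' - h)
          + (M ^ 2 - h ^ 2) by ring]

/-! ### Positivity of the quintic -/

/-- The quintic in `a` whose sign decides `L_{i-1} L_{i+1} < L_i²`. Here `n = i`,
`w = m + 1/2 - i d_i / d_{i-1}`, `Q = w² - (n - 1/2)²` and `a = i d_i / d_{i-1}`. -/
def ratioGap (n w Q a : ℝ) : ℝ :=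
  2 * a ^ 5 + 4 * w * a ^ 4 + ((6 * n + 2) * Q + 6 * n ^ 2 + 2 * n - 4) * a ^ 3
    + (8 * n * Q + 4 * n ^ 2 * (n + 1)) * w * a ^ 2
    + (-2 * n * Q ^ 2 + (-4 * n ^ 4 + 10 * n ^ 3 + 5 * n ^ 2 - 9 * n) * Q
      + 4 * n ^ 3 * (n ^ 2 - 1)) * a
    - 4 * n * w * Q ^ 2 - 4 * n ^ 2 * (n ^ 2 - 1) * w * Q

lemma ratioGap_pos_of_half_le {k d p : ℝ} (hk : 0 ≤ k) (hd : 0 ≤ d) (hp : 1 / 2 ≤ p) :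
    0 < ratioGap (k + 1) (k + 1 / 2 + d) (d * (2 * k + 1 + d)) (d * (2 * k + d) + p) := by
  obtain ⟨r, hr, rfl⟩ : ∃ r, 0 ≤ r ∧ p = 1 / 2 + r := ⟨p - 1 / 2, by linarith, by ring⟩
  unfold ratioGap
  ring_nf
  positivity

/-- The coefficients of all positive powers of `p` are nonnegative. -/
lemma ratioGap_mono {k d p : ℝ} (hk : 0 ≤ k) (hd : 0 ≤ d) (hp : 0 ≤ p) :
    ratioGap (k + 1) (k + 1 / 2 + d) (d * (2 * k + 1 + d)) (d * (2 * k + d))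
      ≤ ratioGap (k + 1) (k + 1 / 2 + d) (d * (2 * k + 1 + d)) (d * (2 * k + d) + p) := by
  rw [← sub_nonneg]
  unfold ratioGap
  ring_nf
  positivity

lemma ratioGap_pos_of_zero {d : ℝ} (hd : 3 / 4 ≤ d) :
    0 < ratioGap 1 (1 / 2 + d) (d * (1 + d)) (d * d) := by
  obtain ⟨r, hr, rfl⟩ : ∃ r, 0 ≤ r ∧ d = 3 / 4 + r := ⟨d - 3 / 4, by linarith, by ring⟩
  unfold ratioGap
  ring_nf
  positivity

lemma ratioGap_pos_of_one_le {k d : ℝ} (hk : 1 ≤ k) (hd : 0 < d)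
    (hQ : 3 / 2 ≤ d * (2 * k + 1 + d)) :
    0 < ratioGap (k + 1) (k + 1 / 2 + d) (d * (2 * k + 1 + d)) (d * (2 * k + d)) := by
  obtain ⟨r, hr, rfl⟩ : ∃ r, 0 ≤ r ∧ k = 1 + r := ⟨k - 1, by linarith, by ring⟩
  -- `-B * d` is the negative part of the coefficient of `d`; it is absorbed by `d * (…) ≥ 3 / 2`.
  set B : ℝ := 4 * (1 + r) + 10 * (1 + r) ^ 2 + 8 * (1 + r) ^ 3 + 2 * (1 + r) ^ 4 with hB
  have h1 : 0 ≤ B * d * (2 / 3 * (d * (2 * (1 + r) + 1 + d)) - 1) :=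
    mul_nonneg (by positivity) (by linarith)
  have h2 : 0 < ratioGap (1 + r + 1) (1 + r + 1 / 2 + d) (d * (2 * (1 + r) + 1 + d))
      (d * (2 * (1 + r) + d)) - B * d * (2 / 3 * (d * (2 * (1 + r) + 1 + d)) - 1) := by
    rw [hB]
    unfold ratioGap
    ring_nf
    positivity
  linarith

/-- The parameters are those of `ratioGap` for `n = k + 1`, with `d = w - (n - 1/2)` and
`p = m - k - Q`; the last hypothesis says `m - k ≥ 2`. -/
lemma ratioGap_pos {k : ℕ} {d p : ℝ} (hd : 0 ≤ d) (hp : 0 ≤ p)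
    (h : 2 ≤ d * (2 * k + 1 + d) + p) :
    0 < ratioGap (k + 1) (k + 1 / 2 + d) (d * (2 * k + 1 + d)) (d * (2 * k + d) + p) := by
  have hk : (0 : ℝ) ≤ k := k.cast_nonneg
  rcases le_total (1 / 2) p with hp' | hp'
  · exact ratioGap_pos_of_half_le hk hd hp'
  refine lt_of_lt_of_le ?_ (ratioGap_mono hk hd hp)
  have hQ : 3 / 2 ≤ d * (2 * k + 1 + d) := by linarith
  rcases k.eq_zero_or_pos with rfl | hk1
  · have : 3 / 4 ≤ d := by
      simp only [Nat.cast_zero] at hQ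
      nlinarith
    simpa using ratioGap_pos_of_zero this
  · refine ratioGap_pos_of_one_le (by exact_mod_cast hk1) (lt_of_le_of_ne hd ?_) hQ
    rintro rfl
    norm_num at hQ

/-! ### Log-concavity and 2-log-concavity -/

lemma borosMollCoeff_sq_sub_pos (m : ℕ) {i : ℤ} (hi0 : 0 ≤ i) (him : i ≤ m) :
    0 < borosMollCoeff m i ^ 2 - borosMollCoeff m (i - 1) * borosMollCoeff m (i + 1) := by
  have hpos : 0 < borosMollCoeff m i := by
    simpa using (exists_ratio_parameter m (i := i + 1) (by omega) (by omega)).1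
  rcases hi0.eq_or_lt with rfl | hi
  · rw [borosMollCoeff_of_neg (by omega : (0 : ℤ) - 1 < 0), zero_mul, sub_zero]
    positivity
  obtain ⟨hx, w, hw, hlo, -⟩ := exists_ratio_parameter m (i := i) (by omega) (by omega)
  have hr := borosMollCoeff_recurrence m (i := i) hi0
  have hi1 : (1 : ℝ) ≤ i := by exact_mod_cast hi
  have hn : (0 : ℝ) < i := by linarith
  set x := borosMollCoeff m (i - 1)
  set M : ℝ := (m : ℝ) + 1 / 2 with hM
  set a := M - w with ha
  have hapos : 0 < a := by
    have : 0 < a * x := by rw [← hw]; positivity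
    exact (pos_iff_pos_of_mul_pos this).mpr hx
  have hQ : 0 ≤ w ^ 2 - ((i : ℝ) - 1 / 2) ^ 2 := by nlinarith
  have e1 : borosMollCoeff m i = a * x / i := by field_simp; linear_combination hw
  have e2 : borosMollCoeff m (i + 1)
      = (a ^ 2 - (w ^ 2 - ((i : ℝ) - 1 / 2) ^ 2)) * x / (i * (i + 1)) := by
    rw [eq_div_iff (by positivity)]
    linear_combination hr + (2 * m + 1) * hw
  rw [e1, e2]
  have : (a * x / i) ^ 2 - x * ((a ^ 2 - (w ^ 2 - ((i : ℝ) - 1 / 2) ^ 2)) * x / (i * (i + 1)))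
      = x ^ 2 * (a ^ 2 + i * (w ^ 2 - ((i : ℝ) - 1 / 2) ^ 2)) / (i ^ 2 * (i + 1)) := by
    field_simp
    ring
  rw [this]
  positivity

/-- The inequality `L_{i-1} L_{i+1} < L_i²`. After division by `d_{i-1}⁴` the difference of the two
sides is a positive multiple of `ratioGap`. -/
lemma borosMollCoeff_log_concave_twice (m : ℕ) {i : ℤ} (hi1 : 1 ≤ i) (him : i ≤ (m : ℤ) - 1) :
    (borosMollCoeff m (i - 1) ^ 2 - borosMollCoeff m (i - 2) * borosMollCoeff m i)
      * (borosMollCoeff m (i + 1) ^ 2 - borosMollCoeff m i * borosMollCoeff m (i + 2))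
      < (borosMollCoeff m i ^ 2 - borosMollCoeff m (i - 1) * borosMollCoeff m (i + 1)) ^ 2 := by
  have hpos : 0 < borosMollCoeff m i := by
    simpa using (exists_ratio_parameter m (i := i + 1) (by omega) (by omega)).1
  obtain ⟨hx, w, hw, hlo, hhi⟩ := exists_ratio_parameter m hi1 (by omega)
  obtain ⟨k, rfl⟩ : ∃ k : ℕ, i = k + 1 := ⟨(i - 1).toNat, by omega⟩
  have hkm : (k : ℝ) + 2 ≤ m := by exact_mod_cast (by omega : k + 2 ≤ m)
  have hk0 : (0 : ℝ) ≤ k := k.cast_nonneg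
  have r0 := borosMollCoeff_recurrence m (i := k) (by omega)
  have r1 := borosMollCoeff_recurrence m (i := k + 1) (by omega)
  have r2 := borosMollCoeff_recurrence m (i := k + 2) (by omega)
  rw [show (k : ℤ) + 1 - 1 = k by ring] at *
  rw [show (k : ℤ) + 1 - 2 = k - 1 by ring, show (k : ℤ) + 1 + 1 = k + 2 by ring,
    show (k : ℤ) + 1 + 2 = k + 3 by ring]
  rw [show (k : ℤ) + 1 + 1 = k + 2 by ring] at r1
  rw [show (k : ℤ) + 2 + 1 = k + 3 by ring, show (k : ℤ) + 2 - 1 = k + 1 by ring] at r2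
  push_cast at r0 r1 r2 hw hlo hhi
  set x := borosMollCoeff m k
  obtain ⟨d, rfl⟩ : ∃ d, w = k + 1 / 2 + d := ⟨w - (k + 1 / 2), by ring⟩
  obtain ⟨p, hp⟩ : ∃ p, (m : ℝ) = k + d * (2 * k + 1 + d) + p :=
    ⟨m - k - d * (2 * k + 1 + d), by ring⟩
  have hd0 : 0 ≤ d := by linarith
  have hp0 : 0 ≤ p := by nlinarith
  have hgap := ratioGap_pos (k := k) hd0 hp0 (by linarith)
  obtain ⟨a, ha⟩ : ∃ a, a = d * (2 * k + d) + p := ⟨_, rfl⟩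
  rw [← ha] at hgap
  have haw : (m : ℝ) = a + k + d := by rw [hp, ha]; ring
  have hapos : 0 < a := by
    have h1 : 0 < a * x := by
      have : a * x = (k + 1) * borosMollCoeff m (k + 1) := by rw [hw, haw]; ring
      rw [this]; positivity
    exact (pos_iff_pos_of_mul_pos h1).mpr hx
  rw [haw] at r0 r1 r2 hw
  -- `V` is the coefficient of `d_{i-2}` in the recurrence, written in terms of `a`.
  obtain ⟨V, hV⟩ : ∃ V : ℝ, V = (a + k + d + 1 - k) * (a + k + d + k) := ⟨_, rfl⟩
  have hVpos : 0 < V := by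
    rw [hV]
    have : 0 < a + k + d + 1 - k := by linarith
    positivity
  have e1 : borosMollCoeff m (k + 1) = a * x / (k + 1) := by
    field_simp
    linear_combination hw
  have e2 : borosMollCoeff m (k + 2)
      = (a ^ 2 - d * (2 * k + 1 + d)) * x / ((k + 1) * (k + 2)) := by
    field_simp
    linear_combination r1 + (2 * (a + k + d) + 1) * hw
  have e3 : borosMollCoeff m (k + 3) = ((2 * (a + k + d) + 1) * (a ^ 2 - d * (2 * k + 1 + d))
      - (a + d - 1) * (a + 2 * k + d + 2) * a) * x / ((k + 1) * (k + 2) * (k + 3)) := by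
    rw [e1, e2] at r2
    field_simp
    field_simp at r2
    linear_combination r2
  have e0 : borosMollCoeff m (k - 1) = k * (2 * (a + k + d) + 1 - a) * x / V := by
    rw [e1, ← hV] at r0
    field_simp
    field_simp at r0
    linear_combination r0
  rw [e0, e1, e2, e3, ← sub_pos]
  have key : ((a * x / (k + 1)) ^ 2
        - x * ((a ^ 2 - d * (2 * k + 1 + d)) * x / ((k + 1) * (k + 2)))) ^ 2
      - (x ^ 2 - k * (2 * (a + k + d) + 1 - a) * x / V * (a * x / (k + 1)))
        * (((a ^ 2 - d * (2 * k + 1 + d)) * x / ((k + 1) * (k + 2))) ^ 2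
          - a * x / (k + 1) * (((2 * (a + k + d) + 1) * (a ^ 2 - d * (2 * k + 1 + d))
            - (a + d - 1) * (a + 2 * k + d + 2) * a) * x / ((k + 1) * (k + 2) * (k + 3))))
      = x ^ 4 * a * ratioGap (k + 1) (k + 1 / 2 + d) (d * (2 * k + 1 + d)) a
        / ((k + 1) ^ 4 * (k + 2) ^ 2 * (k + 3) * V) := by
    unfold ratioGap
    field_simp
    rw [hV]
    ring
  rw [key]
  positivity

lemma zeroExtend_logConcaveOp_borosMollSeq (m : ℕ) {i : ℤ} (hi0 : 0 ≤ i) (him : i ≤ m) :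
    zeroExtend (logConcaveOp (borosMollSeq m)) i
      = borosMollCoeff m i ^ 2 - borosMollCoeff m (i - 1) * borosMollCoeff m (i + 1) := by
  obtain ⟨n, rfl⟩ := Int.eq_ofNat_of_zero_le hi0
  rw [zeroExtend, dif_pos ⟨hi0, him⟩]
  rfl

theorem theorem1p4 (m : ℕ) :
    IsKLogConcaveSeq 2 (borosMollSeq m) ∧
    ∀ i : ℤ, 1 ≤ i → i ≤ (m : ℤ) - 1 →
      0 < borosMollCoeff m i ^ 2 - borosMollCoeff m (i - 1) * borosMollCoeff m (i + 1) ∧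
      0 < borosMollCoeff m (i + 1) ^ 2 - borosMollCoeff m i * borosMollCoeff m (i + 2) ∧
      (borosMollCoeff m (i - 1) ^ 2 - borosMollCoeff m (i - 2) * borosMollCoeff m i)
          / (borosMollCoeff m i ^ 2 - borosMollCoeff m (i - 1) * borosMollCoeff m (i + 1))
        < (borosMollCoeff m i ^ 2 - borosMollCoeff m (i - 1) * borosMollCoeff m (i + 1))
          / (borosMollCoeff m (i + 1) ^ 2 - borosMollCoeff m i * borosMollCoeff m (i + 2)) := by
  constructor
  · intro j hj i hi1 him
    interval_cases j
    · have h := borosMollCoeff_sq_sub_pos m (i := i) (by omega) him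
      rw [mul_comm] at h
      exact h.le
    · simp only [Function.iterate_one]
      rcases him.eq_or_lt with rfl | hlt
      -- At the last index the neighbour `L_{m+1}` is zero by convention.
      · have h0 : zeroExtend (logConcaveOp (borosMollSeq m)) ((m : ℤ) + 1) = 0 :=
          dif_neg (by omega)
        rw [h0, zero_mul, sub_zero]
        positivity
      · have h := borosMollCoeff_log_concave_twice m hi1 (by omega)
        rw [zeroExtend_logConcaveOp_borosMollSeq m (by omega) him,
          zeroExtend_logConcaveOp_borosMollSeq m (by omega) (by omega),
          zeroExtend_logConcaveOp_borosMollSeq m (by omega) (by omega),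
          show i + 1 - 1 = i by ring, show i + 1 + 1 = i + 2 by ring,
          show i - 1 - 1 = i - 2 by ring, show i - 1 + 1 = i by ring]
        linarith
  · intro i hi1 him
    have h1 := borosMollCoeff_sq_sub_pos m (i := i) (by omega) (by omega)
    have h2 := borosMollCoeff_sq_sub_pos m (i := i + 1) (by omega) (by omega)
    rw [show i + 1 - 1 = i by ring, show i + 1 + 1 = i + 2 by ring] at h2
    refine ⟨h1, h2, ?_⟩
    rw [div_lt_div_iff₀ h1 h2, ← sq]
    exact borosMollCoeff_log_concave_twice m hi1 him
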